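/- **Theorem 1.1.** Let $f(x)\in\mathbb Z[x]$ be monic of degree $n$ and irreducible over $\mathbb Q$. Call $f$ *cyclic* if its Galois group over $\mathbb Q$ is cyclic of order $n$, and *monogenic* if, for $f(\theta)=0$, $\{1,\theta,\dots,\theta^{n-1}\}$ is a $\mathbb Z$-basis of the ring of integers of $\mathbb Q(\theta)$. Call two polynomials *equivalent* if their splitting fields over $\mathbb Q$ (inside $\mathbb C$) are equal. For $k\in\mathbb Z$ put $\delta_1(k)=9k^2+3k+1$ and $\delta_2(k)=27k^2+27k+7$, and let $$\mathcal F_1=\{x^3-3\delta_1(k)x+(6k+1)\delta_1(k) : k\in\mathbb Z,\ \delta_1(k)\text{ squarefree}\},$$ $$\mathcal F_2=\{x^3-\delta_2(k)x+(2k+1)\delta_2(k) : k\in\mathbb Z,\ k\ge 0,\ \delta_2(k)\text{ squarefree}\}.$$ 1. $\mathcal F_1$ and $\mathcal F_2$ are infinite; each of their elements is a monogenic cyclic trinomial of the form $x^3+Ax+B$ with $A,B\in\mathbb Z$, $AB\neq0$; $\mathcal F_1\cap\mathcal F_2=\varnothing$; and no two distinct elements of $\mathcal F_1\cup\mathcal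 F_2$ are equivalent. 2. There are exactly four monogenic cyclic trinomials of the form $x^3+Ax^2+B$ with $A,B\in\mathbb Z$, $AB\ne0$, namely $$x^3+3x^2-3,\quad x^3-3x^2+3,\quad x^3-3x^2+1,\quad x^3+3x^2-1,$$ and they are all equivalent to $x^3-3x+1$, which belongs to $\mathcal F_1$. -/

import Mathlib

open Polynomial IntermediateField

/-- `f ∈ ℤ[x]` is monic and irreducible over `ℚ`. -/
def IsMonicIrred (f : ℤ[X]) : Prop :=
  f.Monic ∧ Irreducible (f.map (Int.castRingHom ℚ))

/-- A monic polynomial `f ∈ ℤ[x]` of degree `n`, irreducible over `ℚ`, is *cyclic* if its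
Galois group over `ℚ` is the cyclic group of order `n`. -/
def IsCyclicPoly (f : ℤ[X]) : Prop :=
  IsMonicIrred f ∧
    IsCyclic (f.map (Int.castRingHom ℚ)).Gal ∧
    Nat.card (f.map (Int.castRingHom ℚ)).Gal = f.natDegree

/-- A monic polynomial `f ∈ ℤ[x]` of degree `n`, irreducible over `ℚ`, is *monogenic* if, for
its roots `θ`, the powers `1, θ, …, θ ^ (n - 1)` form a `ℤ`-basis of the ring of integers of
`ℚ(θ)`. -/
def IsMonogenicPoly (f : ℤ[X]) : Prop :=
  IsMonicIrred f ∧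
    ∀ θ : ℂ, aeval θ f = 0 →
      ∃ b : Module.Basis (Fin f.natDegree) ℤ (NumberField.RingOfIntegers ℚ⟮θ⟯),
        ∀ i, (((b i : NumberField.RingOfIntegers ℚ⟮θ⟯) : ℚ⟮θ⟯) : ℂ) = θ ^ (i : ℕ)

/-- The splitting field of `f ∈ ℤ[x]` over `ℚ`, as a subfield of `ℂ`. -/
noncomputable def splittingFieldIn (f : ℤ[X]) : IntermediateField ℚ ℂ :=
  IntermediateField.adjoin ℚ {z : ℂ | aeval z f = 0}

/-- Two polynomials are *equivalent* if their splitting fields are equal. -/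
def PolyEquivalent (f g : ℤ[X]) : Prop :=
  splittingFieldIn f = splittingFieldIn g

def delta1 (k : ℤ) : ℤ := 9 * k ^ 2 + 3 * k + 1

def delta2 (k : ℤ) : ℤ := 27 * k ^ 2 + 27 * k + 7

/-- The trinomials `x³ - 3δ₁x + (6k+1)δ₁` with `k ∈ ℤ` and `δ₁ = 9k² + 3k + 1` squarefree. -/
def Family1 : Set ℤ[X] :=
  {f | ∃ k : ℤ, Squarefree (delta1 k) ∧
    f = X ^ 3 - C (3 * delta1 k) * X + C ((6 * k + 1) * delta1 k)}

/-- The trinomials `x³ - δ₂x + (2k+1)δ₂` with `k ≥ 0` and `δ₂ = 27k² + 27k + 7` squarefree. -/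
def Family2 : Set ℤ[X] :=
  {f | ∃ k : ℤ, 0 ≤ k ∧ Squarefree (delta2 k) ∧
    f = X ^ 3 - C (delta2 k) * X + C ((2 * k + 1) * delta2 k)}

/-- The four trinomials `x³ + 3x² - 3`, `x³ - 3x² + 3`, `x³ - 3x² + 1`, `x³ + 3x² - 1`. -/
def FourTrinomials : Set ℤ[X] :=
  {X ^ 3 + 3 * X ^ 2 - 3, X ^ 3 - 3 * X ^ 2 + 3, X ^ 3 - 3 * X ^ 2 + 1, X ^ 3 + 3 * X ^ 2 - 1}

/-! An irreducible cubic is cyclic exactly when its discriminant is a nonzero square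
(`isCyclicPoly_of_discr_eq_sq`, `exists_sq_eq_discr_of_isCyclicPoly`), and a monogenic one has the
discriminant of its root field. For cyclic cubics the root field is the splitting field, so
equivalent monogenic cyclic cubics share their discriminant
(`monicCubicDiscr_eq_of_polyEquivalent`). In the families it is `(9δ₁)²` and `δ₂²` with `3 ∤ δ₂`,
which separates all members.

Monogenicity is proved by finding, at each prime dividing the discriminant, a translate that is
Eisenstein (`isMonogenicPoly_of_eisenstein`). It is refuted by `p² ∣ f(r)` and `p ∣ f'(r)`, which
produce an integral element outside `ℤ[θ]` (`not_isMonogenicPoly_of_sq_dvd_eval`).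

The families are infinite because `δ₁` and `δ₂` take infinitely many squarefree values: multiples of
`p²` fill at most two residue classes for each prime `p ≥ 5`, and a sieve using Chebyshev's bound
leaves a positive proportion.

For `x³ + Ax² + B`, the square discriminant and the obstruction give `4A³ = -B(m² + 27)` with `B`
squarefree and `m` a power of `3` up to sign; only `m = ±3, ±9` survive (`eq_of_discr_eq_sq`). -/

/-- The monic cubic `x³ + ax² + bx + c`. -/
noncomputable def monicCubic (a b c : ℤ) : ℤ[X] := X ^ 3 + C a * X ^ 2 + C b * X + C c

/-- The discriminant of `x³ + ax² + bx + c`. -/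
def monicCubicDiscr {R : Type*} [CommRing R] (a b c : R) : R :=
  a ^ 2 * b ^ 2 - 4 * b ^ 3 - 4 * a ^ 3 * c + 18 * a * b * c - 27 * c ^ 2

/-! ### Discriminant and roots of a cubic -/

section Cubic

variable {R : Type*} [CommRing R]

theorem map_monicCubicDiscr {S : Type*} [CommRing S] (φ : R →+* S) (a b c : R) :
    φ (monicCubicDiscr a b c) = monicCubicDiscr (φ a) (φ b) (φ c) := by
  simp [monicCubicDiscr, map_ofNat φ]

/-- The second factor is the discriminant of the quadratic `f/(x - t)`, whose value at `t` is
`f'(t)`. If `disc f` is a square, that quadratic therefore splits over the field of `t`. -/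
theorem deriv_sq_mul_eq_monicCubicDiscr {a b c t : R} (h : t ^ 3 + a * t ^ 2 + b * t + c = 0) :
    (3 * t ^ 2 + 2 * a * t + b) ^ 2 * ((a + t) ^ 2 - 4 * (b + t * (a + t))) =
      monicCubicDiscr a b c := by
  unfold monicCubicDiscr
  linear_combination (-27 * t ^ 3 - 27 * a * t ^ 2 - 27 * b * t + 4 * a ^ 3 - 18 * a * b +
    27 * c) * h

theorem vieta_of_distinct_roots [IsDomain R] {a b c x y z : R}
    (hx : x ^ 3 + a * x ^ 2 + b * x + c = 0) (hy : y ^ 3 + a * y ^ 2 + b * y + c = 0)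
    (hz : z ^ 3 + a * z ^ 2 + b * z + c = 0) (hxy : x ≠ y) (hxz : x ≠ z) (hyz : y ≠ z) :
    a = -(x + y + z) ∧ b = x * y + x * z + y * z ∧ c = -(x * y * z) := by
  have h1 : x ^ 2 + x * y + y ^ 2 + a * (x + y) + b = 0 := by
    apply mul_left_cancel₀ (sub_ne_zero.2 hxy)
    linear_combination hx - hy
  have h2 : x ^ 2 + x * z + z ^ 2 + a * (x + z) + b = 0 := by
    apply mul_left_cancel₀ (sub_ne_zero.2 hxz)
    linear_combination hx - hz
  have ha : a = -(x + y + z) := by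
    have : x + y + z + a = 0 := by
      apply mul_left_cancel₀ (sub_ne_zero.2 hyz)
      linear_combination h1 - h2
    linear_combination this
  have hb : b = x * y + x * z + y * z := by
    rw [ha] at h1
    linear_combination h1
  refine ⟨ha, hb, ?_⟩
  rw [ha, hb] at hx
  linear_combination hx

theorem monicCubicDiscr_eq_of_distinct_roots [IsDomain R] {a b c x y z : R}
    (hx : x ^ 3 + a * x ^ 2 + b * x + c = 0) (hy : y ^ 3 + a * y ^ 2 + b * y + c = 0)
    (hz : z ^ 3 + a * z ^ 2 + b * z + c = 0) (hxy : x ≠ y) (hxz : x ≠ z) (hyz : y ≠ z) :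
    monicCubicDiscr a b c = ((x - y) * (x - z) * (y - z)) ^ 2 := by
  obtain ⟨rfl, rfl, rfl⟩ := vieta_of_distinct_roots hx hy hz hxy hxz hyz
  unfold monicCubicDiscr
  ring

end Cubic

/-- If the discriminant is a square, one root of a cubic generates all of them. -/
theorem root_mem_of_monicCubicDiscr_eq_sq {F E : Type*} [Field F] [CharZero F] [Field E]
    [Algebra F E] (K : IntermediateField F E) {a b c d : F} {t z : E}
    (hd : d ^ 2 = monicCubicDiscr a b c) (hd0 : d ≠ 0)
    (ht : t ^ 3 + algebraMap F E a * t ^ 2 + algebraMap F E b * t + algebraMap F E c = 0)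
    (hz : z ^ 3 + algebraMap F E a * z ^ 2 + algebraMap F E b * z + algebraMap F E c = 0)
    (htK : t ∈ K) : z ∈ K := by
  have : CharZero E := charZero_of_injective_algebraMap (algebraMap F E).injective
  have hD := deriv_sq_mul_eq_monicCubicDiscr ht
  rw [← map_monicCubicDiscr, ← hd, map_pow] at hD
  have hd0' : algebraMap F E d ≠ 0 := by simpa using hd0
  generalize hA : algebraMap F E a = A at *
  generalize hB : algebraMap F E b = B at *
  generalize hC : algebraMap F E c = C' at *
  have hAK : A ∈ K := hA ▸ K.algebraMap_mem a
  have hBK : B ∈ K := hB ▸ K.algebraMap_mem b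
  have hdK : algebraMap F E d ∈ K := K.algebraMap_mem d
  generalize algebraMap F E d = D at *
  have hf0 : 3 * t ^ 2 + 2 * A * t + B ≠ 0 := by
    intro h
    rw [h] at hD
    exact hd0' (pow_eq_zero_iff two_ne_zero |>.1 (by rw [← hD]; ring))
  have hfK : 3 * t ^ 2 + 2 * A * t + B ∈ K := by
    have h3 : (3 : E) ∈ K := ofNat_mem K 3
    have h2 : (2 : E) ∈ K := ofNat_mem K 2
    exact add_mem (add_mem (mul_mem h3 (pow_mem htK _)) (mul_mem (mul_mem h2 hAK) htK)) hBK
  by_cases hzt : z = t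
  · rwa [hzt]
  have hq : z ^ 2 + (A + t) * z + (B + t * (A + t)) = 0 := by
    apply mul_left_cancel₀ (sub_ne_zero.2 hzt)
    linear_combination hz - ht
  have hsq : ((2 * z + A + t) * (3 * t ^ 2 + 2 * A * t + B)) ^ 2 = D ^ 2 := by
    linear_combination hD + 4 * (3 * t ^ 2 + 2 * A * t + B) ^ 2 * hq
  -- The quadratic formula: `2z + A + t = ±D / f'(t)`.
  have key : ∀ e : E, e ∈ K → (2 * z + A + t) * (3 * t ^ 2 + 2 * A * t + B) = e → z ∈ K := by
    intro e he h
    have : z = (e / (3 * t ^ 2 + 2 * A * t + B) - A - t) / 2 := by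
      rw [← h, mul_div_cancel_right₀ _ hf0]
      field_simp
      ring
    rw [this]
    exact div_mem (sub_mem (sub_mem (div_mem he hfK) hAK) htK) (ofNat_mem K 2)
  rcases sq_eq_sq_iff_eq_or_eq_neg.1 hsq with h | h
  · exact key _ hdK h
  · exact key _ (neg_mem hdK) h

/-! ### Integral cubics: irreducibility and Galois group -/

section monicCubic

variable (a b c : ℤ)

theorem monic_monicCubic : (monicCubic a b c).Monic := by
  unfold monicCubic; monicity!

theorem natDegree_monicCubic : (monicCubic a b c).natDegree = 3 := by
  unfold monicCubic; compute_degree!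

theorem monicCubic_eq_iff {a b c a' b' c' : ℤ} :
    monicCubic a b c = monicCubic a' b' c' ↔ a = a' ∧ b = b' ∧ c = c' := by
  refine ⟨fun h ↦ ?_, by rintro ⟨rfl, rfl, rfl⟩; rfl⟩
  have h2 := congrArg (coeff · 2) h
  have h1 := congrArg (coeff · 1) h
  have h0 := congrArg (coeff · 0) h
  simp only [monicCubic, coeff_add, coeff_C_mul, coeff_X_pow, coeff_X, coeff_C] at h0 h1 h2
  norm_num at h0 h1 h2
  exact ⟨h2, h1, h0⟩

variable {a b c}

theorem aeval_monicCubic {E : Type*} [CommRing E] (z : E) :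
    aeval z (monicCubic a b c) = z ^ 3 + a * z ^ 2 + b * z + c := by
  simp [monicCubic]

/-- Modulo `2` the cubic is `x³ + x + 1` or `x³ + x² + 1`, without roots; by Gauss's lemma a
reducible monic integral cubic would have an integer root. -/
theorem isMonicIrred_monicCubic_of_odd (h : Odd (a + b)) (hc : Odd c) :
    IsMonicIrred (monicCubic a b c) := by
  refine ⟨monic_monicCubic a b c, ?_⟩
  have hm := monic_monicCubic a b c
  rw [← algebraMap_int_eq, ← hm.irreducible_iff_irreducible_map_fraction_map,
    hm.irreducible_iff_roots_eq_zero_of_degree_le_three (by rw [natDegree_monicCubic]; norm_num)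
      (by rw [natDegree_monicCubic])]
  refine Multiset.eq_zero_of_forall_notMem fun r hr ↦ ?_
  have hr : r ^ 3 + a * r ^ 2 + b * r + c = 0 := by
    simpa [monicCubic] using (mem_roots'.1 hr).2
  have : Odd (r ^ 3 + a * r ^ 2 + b * r + c) := by
    rcases Int.even_or_odd r with h' | h' <;>
      simp [Int.odd_add, parity_simps, h'] at h ⊢ <;> grind
  rw [hr] at this
  simp at this

end monicCubic

theorem aeval_map_monicCubic {E : Type*} [Field E] [Algebra ℚ E] {a b c : ℤ} (z : E) :
    aeval z ((monicCubic a b c).map (Int.castRingHom ℚ)) = z ^ 3 + a * z ^ 2 + b * z + c := by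
  rw [← algebraMap_int_eq, aeval_map_algebraMap, aeval_monicCubic]

theorem natDegree_map_monicCubic (a b c : ℤ) :
    ((monicCubic a b c).map (Int.castRingHom ℚ)).natDegree = 3 := by
  rw [(monic_monicCubic a b c).natDegree_map, natDegree_monicCubic]

theorem minpoly_eq_map_monicCubic {E : Type*} [Field E] [Algebra ℚ E] {a b c : ℤ} {t : E}
    (h : IsMonicIrred (monicCubic a b c)) (ht : t ^ 3 + a * t ^ 2 + b * t + c = 0) :
    minpoly ℚ t = (monicCubic a b c).map (Int.castRingHom ℚ) :=
  (minpoly.eq_of_irreducible_of_monic h.2 (by rw [aeval_map_monicCubic, ht])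
    (h.1.map _)).symm

theorem isIntegral_of_monicCubic {E : Type*} [CommRing E] {a b c : ℤ} {t : E}
    (ht : t ^ 3 + a * t ^ 2 + b * t + c = 0) : IsIntegral ℤ t :=
  ⟨monicCubic a b c, monic_monicCubic a b c, by
    rw [← aeval_def, aeval_monicCubic, ht]⟩

theorem isIntegral_rat_of_monicCubic {E : Type*} [Field E] [Algebra ℚ E] {a b c : ℤ} {t : E}
    (ht : t ^ 3 + a * t ^ 2 + b * t + c = 0) : IsIntegral ℚ t :=
  ⟨(monicCubic a b c).map (Int.castRingHom ℚ), (monic_monicCubic a b c).map _, by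
    rw [← aeval_def, aeval_map_monicCubic, ht]⟩

theorem finrank_adjoin_root {E : Type*} [Field E] [Algebra ℚ E] {a b c : ℤ} {t : E}
    (h : IsMonicIrred (monicCubic a b c)) (ht : t ^ 3 + a * t ^ 2 + b * t + c = 0) :
    Module.finrank ℚ ℚ⟮t⟯ = 3 := by
  rw [adjoin.finrank (isIntegral_rat_of_monicCubic ht), minpoly_eq_map_monicCubic h ht,
    natDegree_map_monicCubic]

theorem finrank_splittingField_of_discr_eq_sq {a b c d : ℤ} (L : Type*) [Field L] [Algebra ℚ L]
    [IsSplittingField ℚ L ((monicCubic a b c).map (Int.castRingHom ℚ))]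
    (h : IsMonicIrred (monicCubic a b c))
    (hd : d ^ 2 = monicCubicDiscr a b c) (hd0 : d ≠ 0) : Module.finrank ℚ L = 3 := by
  obtain ⟨t, ht⟩ := (IsSplittingField.splits L ((monicCubic a b c).map
    (Int.castRingHom ℚ))).exists_eval_eq_zero (by
      rw [degree_map]
      exact (degree_pos_of_irreducible h.2).ne')
  rw [eval_map_algebraMap, aeval_map_monicCubic] at ht
  rw [← finrank_adjoin_root h ht, ← IntermediateField.finrank_top', eq_comm]
  suffices ℚ⟮t⟯ = ⊤ by rw [this]
  rw [eq_top_iff, ← toSubalgebra_le_toSubalgebra, top_toSubalgebra]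
  refine (IsSplittingField.adjoin_rootSet L
    ((monicCubic a b c).map (Int.castRingHom ℚ))).symm.le.trans
    (Algebra.adjoin_le fun z hz ↦ ?_)
  have hz := (mem_rootSet'.1 hz).2
  rw [aeval_map_monicCubic] at hz
  refine root_mem_of_monicCubicDiscr_eq_sq (a := (a : ℚ)) (b := (b : ℚ)) (c := (c : ℚ))
    (d := (d : ℚ)) ℚ⟮t⟯ ?_ (by simpa using hd0) (by simpa using ht) (by simpa using hz)
    (mem_adjoin_simple_self ℚ t)
  have := congrArg (Int.castRingHom ℚ) hd
  rw [map_monicCubicDiscr] at this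
  simpa using this

theorem isCyclicPoly_of_discr_eq_sq {a b c d : ℤ} (h : IsMonicIrred (monicCubic a b c))
    (hd : d ^ 2 = monicCubicDiscr a b c) (hd0 : d ≠ 0) : IsCyclicPoly (monicCubic a b c) := by
  have hcard : Nat.card ((monicCubic a b c).map (Int.castRingHom ℚ)).Gal = 3 := by
    rw [Gal.card_of_separable h.2.separable]
    exact finrank_splittingField_of_discr_eq_sq _ h hd hd0
  refine ⟨h, ?_, ?_⟩
  · have : Fact (Nat.Prime 3) := ⟨Nat.prime_three⟩
    exact isCyclic_of_prime_card hcard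
  · rw [hcard, natDegree_monicCubic]

/-- The product `δ` of root differences squares to the discriminant, so its degree over `ℚ` is at
most `2`. It also divides `3`, hence `δ` is rational, and being integral it is an integer. -/
theorem exists_sq_eq_discr_of_isCyclicPoly {a b c : ℤ} (h : IsCyclicPoly (monicCubic a b c)) :
    ∃ d : ℤ, d ≠ 0 ∧ d ^ 2 = monicCubicDiscr a b c := by
  obtain ⟨hirr, -, hcard⟩ := h
  rw [Gal.card_of_separable hirr.2.separable, natDegree_monicCubic] at hcard
  have hroots := card_rootSet_eq_natDegree hirr.2.separable
    (SplittingField.splits ((monicCubic a b c).map (Int.castRingHom ℚ)))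
  rw [natDegree_map_monicCubic, ← Nat.card_eq_fintype_card, Nat.card_coe_set_eq,
    Set.ncard_eq_three] at hroots
  obtain ⟨x, y, z, hxy, hxz, hyz, hs⟩ := hroots
  have hmem (w) (hw : w ∈ ({x, y, z} : Set _)) : w ^ 3 + a * w ^ 2 + b * w + c = 0 := by
    rw [← aeval_map_monicCubic]
    exact (mem_rootSet'.1 (hs.symm.le hw)).2
  have hD := monicCubicDiscr_eq_of_distinct_roots (hmem x (by simp)) (hmem y (by simp))
    (hmem z (by simp)) hxy hxz hyz
  set δ := (x - y) * (x - z) * (y - z) with hδ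
  have hδ0 : δ ≠ 0 := by simp [hδ, sub_eq_zero, hxy, hxz, hyz]
  have hmap := map_monicCubicDiscr (Int.castRingHom _) a b c (S :=
    SplittingField ((monicCubic a b c).map (Int.castRingHom ℚ)))
  simp only [eq_intCast] at hmap
  rw [← hmap] at hD
  have hint : IsIntegral ℚ δ := Algebra.IsIntegral.isIntegral δ
  have hdvd := minpoly.degree_dvd hint
  have hle : (minpoly ℚ δ).natDegree ≤ 2 := by
    have : minpoly ℚ δ ∣ X ^ 2 - C ((monicCubicDiscr a b c : ℤ) : ℚ) :=
      minpoly.dvd _ _ (by simp [hD])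
    refine (natDegree_le_of_dvd this (X_pow_sub_C_ne_zero two_pos _)).trans ?_
    rw [natDegree_X_pow_sub_C]
  have hone : (minpoly ℚ δ).natDegree = 1 := by
    rw [hcard] at hdvd
    have := (Nat.dvd_prime Nat.prime_three).1 hdvd
    lia
  obtain ⟨q, hq⟩ := minpoly.natDegree_eq_one_iff.1 hone
  have hq2 : q ^ 2 = ((monicCubicDiscr a b c : ℤ) : ℚ) := by
    apply (algebraMap ℚ (SplittingField ((monicCubic a b c).map (Int.castRingHom ℚ)))).injective
    rw [map_pow, hq, ← hD]
    simp
  have hqint : IsIntegral ℤ q := IsIntegral.of_pow two_pos (hq2 ▸ isIntegral_algebraMap)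
  obtain ⟨d, rfl⟩ := IsIntegrallyClosed.isIntegral_iff.1 hqint
  refine ⟨d, ?_, by rw [eq_intCast] at hq2; exact_mod_cast hq2⟩
  rintro rfl
  exact hδ0 (by rw [← hq]; simp)

theorem splittingFieldIn_monicCubic {a b c d : ℤ} {t : ℂ}
    (hd : d ^ 2 = monicCubicDiscr a b c) (hd0 : d ≠ 0)
    (ht : t ^ 3 + a * t ^ 2 + b * t + c = 0) :
    splittingFieldIn (monicCubic a b c) = ℚ⟮t⟯ := by
  refine le_antisymm (adjoin_le_iff.2 fun z hz ↦ ?_) (adjoin.mono _ _ _ ?_)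
  · rw [Set.mem_ofPred_eq, aeval_monicCubic] at hz
    refine root_mem_of_monicCubicDiscr_eq_sq (a := (a : ℚ)) (b := (b : ℚ)) (c := (c : ℚ))
      (d := (d : ℚ)) ℚ⟮t⟯ ?_ (by simpa using hd0) (by simpa using ht) (by simpa using hz)
      (mem_adjoin_simple_self ℚ t)
    have := congrArg (Int.castRingHom ℚ) hd
    rw [map_monicCubicDiscr] at this
    simpa using this
  · rw [Set.singleton_subset_iff, Set.mem_ofPred_eq, aeval_monicCubic, ht]

/-! ### Monogenicity: field discriminant, Dedekind obstruction, Eisenstein translates -/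

theorem discr_powers_eq_monicCubicDiscr {a b c : ℤ} {t : ℂ} (h : IsMonicIrred (monicCubic a b c))
    (ht : t ^ 3 + a * t ^ 2 + b * t + c = 0) :
    Algebra.discr ℚ (fun i : Fin 3 ↦ AdjoinSimple.gen ℚ t ^ (i : ℕ)) =
      (monicCubicDiscr a b c : ℤ) := by
  have hint := isIntegral_rat_of_monicCubic ht
  have : FiniteDimensional ℚ ℚ⟮t⟯ := adjoin.finiteDimensional hint
  have hcard : Fintype.card (ℚ⟮t⟯ →ₐ[ℚ] ℂ) = Fintype.card (Fin 3) := by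
    rw [AlgHom.card, finrank_adjoin_root h ht, Fintype.card_fin]
  let e : Fin 3 ≃ (ℚ⟮t⟯ →ₐ[ℚ] ℂ) := (Fintype.equivOfCardEq hcard).symm
  have hgen : AdjoinSimple.gen ℚ t ^ 3 + a * AdjoinSimple.gen ℚ t ^ 2 + b * AdjoinSimple.gen ℚ t
      + c = 0 := by
    apply Subtype.val_injective
    simpa using ht
  have hroot (i) : e i (AdjoinSimple.gen ℚ t) ^ 3 + a * e i (AdjoinSimple.gen ℚ t) ^ 2
      + b * e i (AdjoinSimple.gen ℚ t) + c = 0 := by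
    simpa using congrArg (e i) hgen
  have hne (i j) (hij : i ≠ j) : e i (AdjoinSimple.gen ℚ t) ≠ e j (AdjoinSimple.gen ℚ t) := by
    intro heq
    refine hij (e.injective ((adjoin.powerBasis hint).algHom_ext ?_))
    rw [adjoin.powerBasis_gen]
    exact heq
  have hD := monicCubicDiscr_eq_of_distinct_roots (hroot 0) (hroot 1) (hroot 2)
    (hne 0 1 (by decide)) (hne 0 2 (by decide)) (hne 1 2 (by decide))
  apply (algebraMap ℚ ℂ).injective
  -- The discriminant of the powers is the squared Vandermonde determinant of the three conjugates.
  rw [Algebra.discr_eq_det_embeddingsMatrixReindex_pow_two ℚ ℂ _ e]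
  have hmap := map_monicCubicDiscr (Int.castRingHom ℂ) a b c
  simp only [eq_intCast] at hmap
  rw [map_intCast, hmap, hD, Matrix.det_fin_three]
  simp [Algebra.embeddingsMatrixReindex, Algebra.embeddingsMatrix]
  ring

theorem discr_eq_of_isMonogenicPoly {a b c : ℤ} {t : ℂ} (h : IsMonogenicPoly (monicCubic a b c))
    (ht : t ^ 3 + a * t ^ 2 + b * t + c = 0) [NumberField ℚ⟮t⟯] :
    NumberField.discr ℚ⟮t⟯ = monicCubicDiscr a b c := by
  obtain ⟨b', hb⟩ := h.2 t (by rw [aeval_monicCubic, ht])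
  rw [← NumberField.discr_eq_discr _ b']
  apply Int.cast_injective (α := ℚ)
  rw [← discr_powers_eq_monicCubicDiscr h.1 ht, ← eq_intCast (algebraMap ℤ ℚ),
    ← Algebra.discr_localizationLocalization ℤ (nonZeroDivisors ℤ) ℚ⟮t⟯ b']
  rw [← Algebra.discr_reindex _ _ (finCongr (natDegree_monicCubic a b c))]
  congr 1
  ext i
  simp only [Function.comp_apply, Module.Basis.localizationLocalization_apply]
  exact hb _

theorem exists_root_monicCubic (a b c : ℤ) : ∃ t : ℂ, t ^ 3 + a * t ^ 2 + b * t + c = 0 := by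
  obtain ⟨t, ht⟩ := Complex.exists_root (f := (monicCubic a b c).map (Int.castRingHom ℂ)) (by
    rw [← natDegree_pos_iff_degree_pos, (monic_monicCubic a b c).natDegree_map,
      natDegree_monicCubic]
    norm_num)
  exact ⟨t, by simpa [monicCubic] using ht⟩

/-- The obstruction to monogenicity from Dedekind's criterion, for a double root modulo `p`. -/
theorem not_isMonogenicPoly_of_sq_dvd_eval {a b c : ℤ} {p : ℤ} (hp : Prime p) (r : ℤ)
    (h0 : p ^ 2 ∣ r ^ 3 + a * r ^ 2 + b * r + c) (h1 : p ∣ 3 * r ^ 2 + 2 * a * r + b) :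
    ¬ IsMonogenicPoly (monicCubic a b c) := by
  intro h
  obtain ⟨t, ht⟩ := exists_root_monicCubic a b c
  obtain ⟨B, hB⟩ := h.2 t (by rw [aeval_monicCubic, ht])
  obtain ⟨u, hu⟩ := h0
  obtain ⟨v, hv⟩ := h1
  have hp0 : (p : ℂ) ≠ 0 := by simpa using hp.ne_zero
  have hu' : (r : ℂ) ^ 3 + a * r ^ 2 + b * r + c = p ^ 2 * u := by exact_mod_cast hu
  have hv' : 3 * (r : ℂ) ^ 2 + 2 * a * r + b = p * v := by exact_mod_cast hv
  -- Write `f = (x - r)q + f(r)`, so `q(r) = f'(r) = pv`. Then `w = (q(t) - f'(r))/p`, that is, `w +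
  -- v = q(t)/p`.
  set w : ℂ := (t ^ 2 + (r + a) * t - (2 * r ^ 2 + r * a)) / p with hw
  have hpw : p * w = t ^ 2 + (r + a) * t - (2 * r ^ 2 + r * a) := by rw [hw]; field_simp
  have hg : (t - r) * (p * w + p * v) + p ^ 2 * u = 0 := by
    linear_combination ht - hu' - (t - r) * hv' + (t - r) * hpw
  -- Since `(t - r)(w + v) = -pu`, the element `-(w + v)` is formally `pu/(t - r)`; this cubic is
  -- the rescaled reversal of the one satisfied by `t - r`.
  have hW : (-(w + v)) ^ 3 + (v : ℤ) * (-(w + v)) ^ 2 + ((3 * r + a) * u : ℤ) * (-(w + v)) +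
      (p * u ^ 2 : ℤ) = 0 := by
    apply mul_left_cancel₀ (pow_ne_zero 3 hp0)
    push_cast
    linear_combination (-((p * w + p * v) * (t - r + (3 * r + a)) - p ^ 2 * u)) * hg -
      (p * w + p * v) ^ 2 * hpw
  have hwint : IsIntegral ℤ w := by
    have := (isIntegral_of_monicCubic hW).neg.sub (isIntegral_algebraMap (x := v))
    simpa using this
  have hwK : w ∈ ℚ⟮t⟯ := by
    have ht' := mem_adjoin_simple_self ℚ t
    exact div_mem (sub_mem (add_mem (pow_mem ht' _) (mul_mem (add_mem (intCast_mem _ _)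
      (intCast_mem _ _)) ht')) (add_mem (mul_mem (ofNat_mem _ _) (pow_mem (intCast_mem _ _) _))
      (mul_mem (intCast_mem _ _) (intCast_mem _ _)))) (intCast_mem _ _)
  let γ : NumberField.RingOfIntegers ℚ⟮t⟯ := ⟨⟨w, hwK⟩, by
    rw [mem_integralClosure_iff]
    exact (isIntegral_algHom_iff (ℚ⟮t⟯.val.restrictScalars ℤ) Subtype.val_injective).1 hwint⟩
  let i (k : Fin 3) : Fin (monicCubic a b c).natDegree :=
    Fin.cast (natDegree_monicCubic a b c).symm k
  let φ : NumberField.RingOfIntegers ℚ⟮t⟯ →+* ℂ := (algebraMap ℚ⟮t⟯ ℂ).comp (algebraMap _ ℚ⟮t⟯)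
  have hφ : Function.Injective φ :=
    (algebraMap ℚ⟮t⟯ ℂ).injective.comp NumberField.RingOfIntegers.coe_injective
  have hφB (j) : φ (B j) = t ^ (j : ℕ) := hB j
  have hφγ : φ γ = w := rfl
  clear_value γ φ
  obtain ⟨m, hm⟩ : ∃ m : ℤ, m = r + a := ⟨_, rfl⟩
  obtain ⟨n, hn⟩ : ∃ n : ℤ, n = 2 * r ^ 2 + r * a := ⟨_, rfl⟩
  have hγ : p • γ = B (i 2) + m • B (i 1) - n • B (i 0) := by
    apply hφ
    simp only [zsmul_eq_mul, map_add, map_sub, map_mul, map_intCast, hφB, hφγ, hpw]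
    simp [hm, hn, i]
  -- Comparing coordinates at `t²` makes `p` divide `1`.
  have := congrArg (fun x ↦ B.repr x (i 2)) hγ
  have h21 : i 1 ≠ i 2 := by simp [i]
  have h20 : i 0 ≠ i 2 := by simp [i]
  simp only [map_add, map_sub, map_zsmul, Module.Basis.repr_self, Finsupp.coe_add,
    Finsupp.coe_sub, Finsupp.coe_smul, Pi.add_apply, Pi.sub_apply, Pi.smul_apply,
    Finsupp.single_apply, h21, h20, smul_eq_mul] at this
  exact hp.not_isUnit (IsUnit.of_mul_eq_one _ (by simpa using this))

theorem shift_monicCubic_root {R : Type*} [CommRing R] {a b c : ℤ} {t : R}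
    (ht : t ^ 3 + a * t ^ 2 + b * t + c = 0) (r : ℤ) :
    (t - r) ^ 3 + (3 * r + a : ℤ) * (t - r) ^ 2 + (3 * r ^ 2 + 2 * a * r + b : ℤ) * (t - r) +
      (r ^ 3 + a * r ^ 2 + b * r + c : ℤ) = 0 := by
  push_cast
  linear_combination ht

theorem minpoly_int_eq_monicCubic {K : Type*} [Field K] [CharZero K] [Algebra ℚ K] {a b c : ℤ} {t : K}
    (B : PowerBasis ℚ K) (hB : B.gen = t) (hdim : B.dim = 3)
    (ht : t ^ 3 + a * t ^ 2 + b * t + c = 0) : minpoly ℤ t = monicCubic a b c := by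
  have hint := isIntegral_of_monicCubic ht
  refine (eq_of_monic_of_dvd_of_natDegree_le (minpoly.monic hint) (monic_monicCubic a b c)
    (minpoly.isIntegrallyClosed_dvd hint (by rw [aeval_monicCubic, ht])) ?_).symm
  have h1 : (minpoly ℚ t).natDegree = 3 := by rw [← hB, B.natDegree_minpoly, hdim]
  rw [minpoly.isIntegrallyClosed_eq_field_fractions' ℚ hint,
    (minpoly.monic hint).natDegree_map] at h1
  rw [natDegree_monicCubic, h1]

theorem isEisensteinAt_monicCubic {a b c p : ℤ} (hp : Prime p) (ha : p ∣ a) (hb : p ∣ b)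
    (hc : p ∣ c) (hc2 : ¬ p ^ 2 ∣ c) :
    (monicCubic a b c).IsEisensteinAt (Submodule.span ℤ {p}) where
  leading := by
    rw [(monic_monicCubic a b c).leadingCoeff]
    exact fun h ↦ hp.not_isUnit (isUnit_of_dvd_one (Ideal.mem_span_singleton.1 h))
  mem {n} hn := by
    rw [natDegree_monicCubic] at hn
    refine Ideal.mem_span_singleton.2 ?_
    interval_cases n <;> simp only [monicCubic, coeff_add, coeff_C_mul, coeff_X_pow, coeff_X,
      coeff_C] <;> norm_num <;> assumption
  notMem := by
    rw [← Ideal.span, Ideal.span_singleton_pow, Ideal.mem_span_singleton]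
    simpa [monicCubic] using hc2

/-- The hypotheses on `r` say that `f(x + r)` is Eisenstein at `p`. Since `ℤ[t - r] = ℤ[t]`, the
Eisenstein criterion for the index being prime to `p` applies. -/
theorem mem_adjoin_of_prime_zsmul_mem {K : Type*} [Field K] [CharZero K] [Algebra ℚ K] {a b c : ℤ} {t : K}
    (B : PowerBasis ℚ K) (hB : B.gen = t) (hdim : B.dim = 3)
    (ht : t ^ 3 + a * t ^ 2 + b * t + c = 0) {p : ℤ} (hp : Prime p) (r : ℤ)
    (h2 : p ∣ 3 * r + a) (h1 : p ∣ 3 * r ^ 2 + 2 * a * r + b)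
    (h0 : p ∣ r ^ 3 + a * r ^ 2 + b * r + c) (h0' : ¬ p ^ 2 ∣ r ^ 3 + a * r ^ 2 + b * r + c)
    {z : K} (hz : IsIntegral ℤ z) (hpz : p • z ∈ Algebra.adjoin ℤ {t}) :
    z ∈ Algebra.adjoin ℤ {t} := by
  have hs := shift_monicCubic_root ht r
  have hadj : Algebra.adjoin ℤ {t - r} = Algebra.adjoin ℤ {t} := by
    apply le_antisymm
    · exact Algebra.adjoin_singleton_le
        (sub_mem (Algebra.self_mem_adjoin_singleton ℤ t) (intCast_mem _ r))
    · refine Algebra.adjoin_singleton_le ?_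
      have := add_mem (Algebra.self_mem_adjoin_singleton ℤ (t - r)) (intCast_mem _ r)
      rwa [sub_add_cancel] at this
  have htop : Algebra.adjoin ℚ {t - r} = ⊤ := by
    rw [eq_top_iff, ← B.adjoin_gen_eq_top, hB]
    refine Algebra.adjoin_singleton_le ?_
    have := add_mem (Algebra.self_mem_adjoin_singleton ℚ (t - r)) (intCast_mem _ r)
    rwa [sub_add_cancel] at this
  let B' := PowerBasis.ofAdjoinEqTop' (isIntegral_rat_of_monicCubic hs) htop
  have hB' : B'.gen = t - r := PowerBasis.ofAdjoinEqTop'_gen _ _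
  have hdim' : B'.dim = 3 := by rw [← B'.finrank, B.finrank, hdim]
  have hmin := minpoly_int_eq_monicCubic B' hB' hdim' hs
  rw [← hadj, ← hB'] at hpz ⊢
  refine mem_adjoin_of_smul_prime_smul_of_minpoly_isEisensteinAt (K := ℚ) hp
    (hB' ▸ isIntegral_of_monicCubic hs) hz hpz ?_
  rw [hB', hmin]
  exact isEisensteinAt_monicCubic hp h2 h1 h0 h0'

/-- The discriminant multiplies every integral element into `ℤ[g]`; its prime factors are then
removed one at a time, each by its Eisenstein translate. -/
theorem adjoin_eq_integralClosure_of_eisenstein {K : Type*} [Field K] [CharZero K] [Algebra ℚ K]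
    {a b c : ℤ} {g : K} (B : PowerBasis ℚ K) (hBg : B.gen = g) (hdim : B.dim = 3)
    (hgen : g ^ 3 + a * g ^ 2 + b * g + c = 0)
    (hdisc : Algebra.discr ℚ B.basis = (monicCubicDiscr a b c : ℤ))
    (hE : ∀ p : ℤ, Prime p → p ∣ monicCubicDiscr a b c → ∃ r : ℤ, p ∣ 3 * r + a ∧
      p ∣ 3 * r ^ 2 + 2 * a * r + b ∧ p ∣ r ^ 3 + a * r ^ 2 + b * r + c ∧
      ¬ p ^ 2 ∣ r ^ 3 + a * r ^ 2 + b * r + c) :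
    Algebra.adjoin ℤ {g} = integralClosure ℤ K := by
  have hint : IsIntegral ℤ g := isIntegral_of_monicCubic hgen
  have hfin : FiniteDimensional ℚ K := B.finite
  have hstrip (n : ℤ) : n ∣ monicCubicDiscr a b c → n ≠ 0 → ∀ z : K, IsIntegral ℤ z →
      n • z ∈ Algebra.adjoin ℤ {g} → z ∈ Algebra.adjoin ℤ {g} := by
    induction n using UniqueFactorizationMonoid.induction_on_prime with
    | h₁ => exact fun _ h ↦ (h rfl).elim
    | h₂ x hx =>
      intro _ _ z _ hz
      obtain ⟨u, hu⟩ := hx.dvd (a := 1)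
      have := zsmul_mem hz u
      rwa [smul_smul, mul_comm, ← hu, one_smul] at this
    | h₃ m p hm hp ih =>
      intro hdvd _ z hz hmem
      refine ih (dvd_of_mul_left_dvd hdvd) hm z hz ?_
      obtain ⟨r, h2, h1, h0, h0'⟩ := hE p hp (dvd_of_mul_right_dvd hdvd)
      refine mem_adjoin_of_prime_zsmul_mem B hBg hdim hgen hp r h2 h1 h0 h0' (hz.smul m) ?_
      rwa [smul_smul]
  have hD0 : monicCubicDiscr a b c ≠ 0 := by
    intro h0
    apply Algebra.discr_not_zero_of_basis ℚ B.basis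
    rw [hdisc, h0, Int.cast_zero]
  apply le_antisymm
  · exact Algebra.adjoin_singleton_le hint
  · intro z hz
    refine hstrip _ dvd_rfl hD0 z hz ?_
    have := Algebra.discr_mul_isIntegral_mem_adjoin ℚ (B := B) (hBg ▸ hint) hz
    rwa [hdisc, Int.cast_smul_eq_zsmul, hBg] at this

/-- A monic irreducible cubic is monogenic if some translate of it is Eisenstein at each prime
dividing its discriminant. -/
theorem isMonogenicPoly_of_eisenstein {a b c : ℤ} (h : IsMonicIrred (monicCubic a b c))
    (hE : ∀ p : ℤ, Prime p → p ∣ monicCubicDiscr a b c → ∃ r : ℤ, p ∣ 3 * r + a ∧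
      p ∣ 3 * r ^ 2 + 2 * a * r + b ∧ p ∣ r ^ 3 + a * r ^ 2 + b * r + c ∧
      ¬ p ^ 2 ∣ r ^ 3 + a * r ^ 2 + b * r + c) :
    IsMonogenicPoly (monicCubic a b c) := by
  refine ⟨h, fun t ht ↦ ?_⟩
  rw [aeval_monicCubic] at ht
  have hgen : AdjoinSimple.gen ℚ t ^ 3 + a * AdjoinSimple.gen ℚ t ^ 2 + b * AdjoinSimple.gen ℚ t
      + c = 0 := by
    apply Subtype.val_injective
    simpa using ht
  set g := AdjoinSimple.gen ℚ t with hg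
  have hintQ := isIntegral_rat_of_monicCubic ht
  have hint : IsIntegral ℤ g := isIntegral_of_monicCubic hgen
  let B := adjoin.powerBasis hintQ
  have hBg : B.gen = g := adjoin.powerBasis_gen hintQ
  have hdim : B.dim = 3 := by rw [← B.finrank, finrank_adjoin_root h ht]
  have hdisc : Algebra.discr ℚ B.basis = (monicCubicDiscr a b c : ℤ) := by
    rw [← discr_powers_eq_monicCubicDiscr h ht, ← Algebra.discr_reindex _ _ (finCongr hdim)]
    congr 1
    ext i
    simp [hBg, hg]
  have hA : Algebra.adjoin ℤ {g} = integralClosure ℤ ℚ⟮t⟯ :=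
    adjoin_eq_integralClosure_of_eisenstein B hBg hdim hgen (by convert hdisc; exact Subsingleton.elim _ _) hE
  let P : PowerBasis ℤ (NumberField.RingOfIntegers ℚ⟮t⟯) :=
    (Algebra.adjoin.powerBasis' hint).map (Subalgebra.equivOfEq _ _ hA)
  have hPdim : P.dim = (monicCubic a b c).natDegree := by
    rw [← minpoly_int_eq_monicCubic B hBg hdim hgen]
    rfl
  have hPgen : (P.gen : ℚ⟮t⟯) = g := by
    have : (Algebra.adjoin.powerBasis' hint).gen.1 = g := by
      rw [Algebra.adjoin.powerBasis'_gen]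
    exact this
  refine ⟨P.basis.reindex (finCongr hPdim), fun i ↦ ?_⟩
  simp [hPgen, hg]

/-! ### Classification of the trinomials `x³ + Ax² + B` -/

theorem squarefree_of_forall_prime_eval {A B : ℤ} (hB : B ≠ 0)
    (H : ∀ p : ℤ, Prime p → ∀ r : ℤ, p ^ 2 ∣ r ^ 3 + A * r ^ 2 + B → ¬ p ∣ 3 * r ^ 2 + 2 * A * r) :
    Squarefree B := by
  refine (squarefree_iff_no_irreducibles hB).2 fun p hp hpB ↦ ?_
  exact H p hp.prime 0 (by simpa [sq] using hpB) (by simp)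

/-- Away from `3`, the critical point `-2A/3` makes sense modulo `p²`, and `27 f(-2A/3) = 4A³ + 27B
= -Bm²`. If `p ∣ m`, this is the excluded double root. -/
theorem dvd_three_of_prime_dvd {A B m p : ℤ} (hm : 4 * A ^ 3 = -B * (m ^ 2 + 27))
    (H : ∀ p : ℤ, Prime p → ∀ r : ℤ, p ^ 2 ∣ r ^ 3 + A * r ^ 2 + B → ¬ p ∣ 3 * r ^ 2 + 2 * A * r)
    (hp : Prime p) (hpm : p ∣ m) : p ∣ 3 := by
  by_contra h3
  have hcop : IsCoprime (p ^ 2) 3 := (hp.irreducible.coprime_iff_not_dvd.2 h3).pow_left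
  obtain ⟨u, v, huv⟩ := hcop
  obtain ⟨n, rfl⟩ := hpm
  -- `v` inverts `3` modulo `p²`.
  refine H p hp (-2 * A * v) ?_ ⟨-2 * A * v * (2 * A * u * p), by
    linear_combination 4 * A ^ 2 * v * huv⟩
  have hcop27 : IsCoprime (p ^ 2) (3 ^ 3) := IsCoprime.pow_right ⟨u, v, huv⟩
  refine hcop27.dvd_of_dvd_mul_left ?_
  have h3v : 3 * v = 1 - u * p ^ 2 := by linear_combination huv
  have : (3 ^ 3 : ℤ) * ((-2 * A * v) ^ 3 + A * (-2 * A * v) ^ 2 + B) =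
      -8 * A ^ 3 * (3 * v) ^ 3 + 12 * A ^ 3 * (3 * v) ^ 2 + 27 * B := by ring
  rw [this, h3v]
  refine ⟨-B * n ^ 2 + A ^ 3 * (8 * u ^ 3 * p ^ 4 - 12 * u ^ 2 * p ^ 2), ?_⟩
  linear_combination hm

theorem isUnit_of_forall_prime_dvd_three {m : ℤ} (hm : m ≠ 0)
    (h : ∀ p : ℤ, Prime p → p ∣ m → p ∣ 3) (h3 : ¬ (3 : ℤ) ∣ m) : IsUnit m := by
  by_contra hu
  obtain ⟨p, hp, hpm⟩ := WfDvdMonoid.exists_irreducible_factor hu hm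
  exact h3 (((hp.associated_of_dvd Int.prime_three.irreducible
    (h p hp.prime hpm)).symm.dvd).trans hpm)

/-- `H` says that the Dedekind obstruction never occurs. With `d = Bm`, the cases are `m = ±1`,
`±3`, `±9` and `27 ∣ m`: the first makes `49 ∣ B`, the last is obstructed at `3`, and in the middle
ones `B` is `-3a³` or `-a³` with `A = 3a`, so `a = ±1`. -/
theorem eq_of_discr_eq_sq {A B d : ℤ} (hA : A ≠ 0) (hB : B ≠ 0) (hd0 : d ≠ 0)
    (hd : d ^ 2 = -B * (4 * A ^ 3 + 27 * B))
    (H : ∀ p : ℤ, Prime p → ∀ r : ℤ, p ^ 2 ∣ r ^ 3 + A * r ^ 2 + B → ¬ p ∣ 3 * r ^ 2 + 2 * A * r) :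
    A = 3 ∧ B = -3 ∨ A = -3 ∧ B = 3 ∨ A = -3 ∧ B = 1 ∨ A = 3 ∧ B = -1 := by
  have hsq := squarefree_of_forall_prime_eval hB H
  obtain ⟨m, rfl⟩ : B ∣ d :=
    (hsq.dvd_pow_iff_dvd two_ne_zero).1 ⟨-(4 * A ^ 3 + 27 * B), by rw [hd]; ring⟩
  have hm0 : m ≠ 0 := right_ne_zero_of_mul hd0
  have hm : 4 * A ^ 3 = -B * (m ^ 2 + 27) := by
    apply mul_left_cancel₀ hB
    linear_combination hd
  have hprime (n : ℤ) (hn : n ∣ m) (p : ℤ) (hp : Prime p) (hpn : p ∣ n) : p ∣ 3 :=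
    dvd_three_of_prime_dvd hm H hp (hpn.trans hn)
  have hsq' (x : ℤ) (hx : x ^ 2 ∣ B) : x = 1 ∨ x = -1 :=
    Int.isUnit_iff.1 (hsq x (by rwa [← sq]))
  have hpure (a k : ℤ) (h : B = k * a ^ 3) : a = 1 ∨ a = -1 :=
    hsq' a ⟨k * a, by rw [h]; ring⟩
  obtain ⟨k, hk⟩ | - := Int.even_or_odd m
  · exfalso
    have hcop : IsCoprime (2 ^ 2 : ℤ) (m ^ 2 + 27) := ⟨k ^ 2 + 7, -1, by rw [hk]; ring⟩
    have := hsq' 2 (hcop.dvd_of_dvd_mul_right ⟨-A ^ 3, by linear_combination hm⟩)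
    lia
  by_cases h3 : (3 : ℤ) ∣ m
  swap
  · have : m ^ 2 = 1 := by
      rcases Int.isUnit_iff.1 (isUnit_of_forall_prime_dvd_three hm0 (hprime m dvd_rfl) h3)
        with rfl | rfl <;> rfl
    have h7 : A ^ 3 = -7 * B := by rw [this] at hm; linarith
    have hp7 : Prime (7 : ℤ) := by norm_num
    obtain ⟨a, rfl⟩ := hp7.dvd_of_dvd_pow (n := 3) (a := A) ⟨-B, by rw [h7]; ring⟩
    have := hsq' 7 ⟨-a ^ 3, by linarith⟩
    lia
  obtain ⟨n, rfl⟩ := h3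
  have hA3 : (3 : ℤ) ∣ A := Int.prime_three.dvd_of_dvd_pow (n := 3)
    ⟨-3 * B * (n ^ 2 + 3) - A ^ 3, by linear_combination hm⟩
  obtain ⟨a, rfl⟩ := hA3
  have hm' : 12 * a ^ 3 = -B * (n ^ 2 + 3) := by linarith
  by_cases h3 : (3 : ℤ) ∣ n
  swap
  · have : n ^ 2 = 1 := by
      rcases Int.isUnit_iff.1 (isUnit_of_forall_prime_dvd_three (by rintro rfl; simp at hm0)
        (hprime n (by simp)) h3) with rfl | rfl <;> rfl
    have hBa : B = -3 * a ^ 3 := by rw [this] at hm'; linarith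
    rcases hpure a _ hBa with rfl | rfl <;> simp [hBa]
  obtain ⟨n, rfl⟩ := h3
  have hm'' : 4 * a ^ 3 = -B * (3 * n ^ 2 + 1) := by linarith
  by_cases h3 : (3 : ℤ) ∣ n
  swap
  · have : n ^ 2 = 1 := by
      rcases Int.isUnit_iff.1 (isUnit_of_forall_prime_dvd_three (by rintro rfl; simp at hm0)
        (hprime n ⟨9, by ring⟩) h3) with rfl | rfl <;> rfl
    have hBa : B = -1 * a ^ 3 := by rw [this] at hm''; linarith
    rcases hpure a _ hBa with rfl | rfl <;> simp [hBa]
  obtain ⟨n, rfl⟩ := h3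
  exfalso
  have hB9 : ((B : ℤ) : ZMod 9) ≠ 0 := by
    intro h
    have := hsq' 3 (by norm_num; exact (ZMod.intCast_zmod_eq_zero_iff_dvd _ 9).1 h)
    lia
  have hmod : 4 * (a : ZMod 9) ^ 3 = -B := by
    have := congrArg (Int.cast : ℤ → ZMod 9) hm''
    push_cast at this
    have h27 : (3 * (3 * (n : ZMod 9)) ^ 2) = 0 := by
      have : (27 : ZMod 9) = 0 := by decide
      linear_combination (n : ZMod 9) ^ 2 * this
    rw [this, h27]; ring
  -- Modulo `3` the polynomial is `x³ + B`, with triple root `-B`; here its value at `-B` vanishes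
  -- even modulo `9`.
  have hdec : ∀ a B : ZMod 9, 4 * a ^ 3 = -B → B ≠ 0 →
      (-B) ^ 3 + 3 * a * (-B) ^ 2 + B = 0 := by decide
  refine H 3 Int.prime_three (-B) ?_ ⟨B ^ 2 - 2 * a * B, by ring⟩
  have := hdec _ _ hmod hB9
  norm_num
  refine (ZMod.intCast_zmod_eq_zero_iff_dvd _ 9).1 ?_
  push_cast
  linear_combination this

/-! ### Squarefree values of quadratic polynomials -/

theorem eventually_primeCounting_mul_le (C : ℕ) {ε : ℝ} (hε : 0 < ε) :
    ∀ᶠ N : ℕ in Filter.atTop, (Nat.primeCounting (C * N) : ℝ) ≤ ε * N := by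
  rcases Nat.eq_zero_or_pos C with rfl | hC
  · simp only [zero_mul, Nat.primeCounting_zero, Nat.cast_zero]
    exact Filter.Eventually.of_forall fun N ↦ by positivity
  have hC' : (0 : ℝ) < C := by exact_mod_cast hC
  have h1 : ∀ᶠ x : ℝ in Filter.atTop, (Nat.primeCounting ⌊x⌋₊ : ℝ) ≤ ε / C * x := by
    filter_upwards [Chebyshev.eventually_primeCounting_le one_pos,
      Real.tendsto_log_atTop.eventually_ge_atTop ((Real.log 4 + 1) / (ε / C)),
      Filter.eventually_gt_atTop 1] with x hx hlog hx1
    refine hx.trans ?_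
    have hl : 0 < Real.log x := Real.log_pos hx1
    rw [div_le_iff₀ hl]
    rw [div_le_iff₀ (by positivity)] at hlog
    nlinarith
  have h2 : Filter.Tendsto (fun N : ℕ ↦ (C : ℝ) * N) Filter.atTop Filter.atTop :=
    tendsto_natCast_atTop_atTop.const_mul_atTop hC'
  filter_upwards [h2.eventually h1] with N hN
  have : ⌊(C : ℝ) * N⌋₊ = C * N := by exact_mod_cast Nat.floor_natCast (R := ℝ) (C * N)
  rw [this] at hN
  refine hN.trans_eq ?_
  field_simp

theorem card_filter_modEq_le (N v : ℕ) {r : ℕ} (hr : 0 < r) :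
    (((Finset.range N).filter (· ≡ v [MOD r])).card : ℝ) ≤ N / r + 1 := by
  rw [← Nat.count_eq_card_filter_range]
  have := Nat.count_modEq_card N hr v
  rw [this]
  have h1 : ((N / r : ℕ) : ℝ) ≤ N / r := Nat.cast_div_le
  push_cast
  split_ifs <;> simp <;> linarith

/-- A non-squarefree `D k` with `k < N` is divisible by `p²` for a prime `5 ≤ p ≤ CN`, and each such
`p` accounts for at most `2N/p² + 2` values of `k`. -/
theorem infinite_squarefree_of_two_residues (D : ℕ → ℕ) (C : ℕ) (hD0 : ∀ k, D k ≠ 0)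
    (hbound : ∀ k N, k < N → D k ≤ (C * N) ^ 2)
    (h5 : ∀ p k : ℕ, p.Prime → p ^ 2 ∣ D k → 5 ≤ p)
    (hroots : ∀ p : ℕ, p.Prime → ∃ v w, ∀ k, p ^ 2 ∣ D k →
      k ≡ v [MOD p ^ 2] ∨ k ≡ w [MOD p ^ 2]) :
    {k | Squarefree (D k)}.Infinite := by
  intro hfin
  -- With `s` squarefree values in all, the count will read `N ≤ s + N/2 + N/4`: `N/2` from `∑_{n >
  -- 4} 1/n² ≤ 1/4`, `N/4` from `π(CN) ≤ N/8`. So `N > 4s` is contradictory.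
  obtain ⟨N, hN, hN0⟩ := ((eventually_primeCounting_mul_le C (ε := 1 / 8) (by norm_num)).and
    (Filter.eventually_gt_atTop (4 * hfin.toFinset.card))).exists
  set P := (Finset.Ioc 4 (C * N)).filter Nat.Prime with hP
  have hcover : Finset.range N ⊆ hfin.toFinset ∪
      P.biUnion fun p ↦ (Finset.range N).filter (p ^ 2 ∣ D ·) := by
    intro k hk
    by_cases hsq : Squarefree (D k)
    · simp [hsq]
    rw [Nat.squarefree_iff_prime_squarefree] at hsq
    push Not at hsq
    obtain ⟨p, hp, hpD⟩ := hsq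
    rw [← sq] at hpD
    refine Finset.mem_union_right _ (Finset.mem_biUnion.2 ⟨p, ?_, by simpa [hpD] using hk⟩)
    have hle : p ≤ C * N := by
      rw [← Nat.pow_le_pow_iff_left two_ne_zero]
      exact (Nat.le_of_dvd (Nat.pos_of_ne_zero (hD0 k)) hpD).trans
        (hbound k N (Finset.mem_range.1 hk))
    have := h5 p k hp hpD
    simp only [hP, Finset.mem_filter, Finset.mem_Ioc]
    exact ⟨⟨by lia, hle⟩, hp⟩
  have hS (p) (hp : p ∈ P) : (((Finset.range N).filter (p ^ 2 ∣ D ·)).card : ℝ) ≤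
      2 * N * ((p : ℝ) ^ 2)⁻¹ + 2 := by
    have hpp : p.Prime := (Finset.mem_filter.1 hp).2
    obtain ⟨v, w, hvw⟩ := hroots p hpp
    have hsub : (Finset.range N).filter (p ^ 2 ∣ D ·) ⊆
        (Finset.range N).filter (· ≡ v [MOD p ^ 2]) ∪
          (Finset.range N).filter (· ≡ w [MOD p ^ 2]) := by
      intro k hk
      rw [Finset.mem_filter] at hk
      simpa [Finset.mem_range.1 hk.1] using hvw k hk.2
    have h1 : (((Finset.range N).filter (p ^ 2 ∣ D ·)).card : ℝ) ≤ _ :=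
      Nat.cast_le.2 ((Finset.card_le_card hsub).trans (Finset.card_union_le _ _))
    have hpos : 0 < p ^ 2 := pow_pos hpp.pos 2
    have hv := card_filter_modEq_le N v hpos
    have hw := card_filter_modEq_le N w hpos
    push_cast at h1 hv hw
    rw [div_eq_mul_inv] at hv hw
    linarith
  have hPcard : (P.card : ℝ) ≤ 1 / 8 * N := by
    refine le_trans ?_ hN
    rw [← Nat.primesLE_card_eq_primeCounting, Nat.cast_le]
    refine Finset.card_le_card fun p hp ↦ ?_
    simp only [hP, Finset.mem_filter, Finset.mem_Ioc] at hp
    simp [Nat.mem_primesLE, hp.1.2, hp.2]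
  have hsum : ∑ p ∈ P, ((p : ℝ) ^ 2)⁻¹ ≤ 1 / 4 := by
    refine (Finset.sum_le_sum_of_subset_of_nonneg (Finset.filter_subset _ _)
      fun _ _ _ ↦ by positivity).trans ?_
    rcases le_total 4 (C * N) with h | h
    · refine (sum_Ioc_inv_sq_le_sub (by norm_num) h).trans ?_
      have : (0 : ℝ) ≤ ((C * N : ℕ) : ℝ)⁻¹ := by positivity
      norm_num at this ⊢
      linarith
    · rw [Finset.Ioc_eq_empty_of_le h]
      norm_num
  have hcount : (N : ℝ) ≤ hfin.toFinset.card +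
      ∑ p ∈ P, (((Finset.range N).filter (p ^ 2 ∣ D ·)).card : ℝ) := by
    have h1 := (Finset.card_le_card hcover).trans ((Finset.card_union_le _ _).trans
      (Nat.add_le_add_left Finset.card_biUnion_le _))
    rw [Finset.card_range] at h1
    exact_mod_cast h1
  have h2 := Finset.sum_le_sum hS
  rw [Finset.sum_add_distrib, ← Finset.mul_sum, Finset.sum_const, nsmul_eq_mul] at h2
  have h3 : (4 * hfin.toFinset.card : ℝ) < N := by exact_mod_cast hN0
  have h4 : 2 * (N : ℝ) * ∑ p ∈ P, ((p : ℝ) ^ 2)⁻¹ ≤ 2 * N * (1 / 4) := by gcongr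
  linarith

/-- Two values differ by `g(k - k₀)(l(k + k₀) + 1)`. If `p` divided both nonconstant factors, then
`p ∣ 2lk₀ + 1`, and completing the square gives `p ∣ 4le - g`. So `p²` divides one of them. -/
theorem exists_two_residues_of_quadratic {p : ℕ} (hp : p.Prime) {g l e : ℤ}
    (hg : ¬ (p : ℤ) ∣ g) (hl : ¬ (p : ℤ) ∣ l)
    (he : ¬ (p : ℤ) ∣ 4 * l * e - g) :
    ∃ v w : ℕ, ∀ k : ℕ, (p : ℤ) ^ 2 ∣ g * (l * k ^ 2 + k) + e →
      k ≡ v [MOD p ^ 2] ∨ k ≡ w [MOD p ^ 2] := by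
  have hp' : Prime (p : ℤ) := Nat.prime_iff_prime_int.1 hp
  have hcop {x : ℤ} (hx : ¬ (p : ℤ) ∣ x) : IsCoprime ((p : ℤ) ^ 2) x :=
    (hp'.irreducible.coprime_iff_not_dvd.2 hx).pow_left
  have hmod (j k : ℕ) (h : (p : ℤ) ^ 2 ∣ k - j) : k ≡ j [MOD p ^ 2] := by
    rw [Nat.ModEq.comm, Nat.modEq_iff_dvd]
    exact_mod_cast h
  by_cases h0 : ∃ k₀ : ℕ, (p : ℤ) ^ 2 ∣ g * (l * k₀ ^ 2 + k₀) + e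
  swap
  · exact ⟨0, 0, fun k hk ↦ (h0 ⟨k, hk⟩).elim⟩
  obtain ⟨k₀, hk₀⟩ := h0
  have hsplit (k : ℕ) (hk : (p : ℤ) ^ 2 ∣ g * (l * k ^ 2 + k) + e) :
      (p : ℤ) ^ 2 ∣ k - k₀ ∨ (p : ℤ) ^ 2 ∣ l * (k + k₀) + 1 := by
    have hmul : (p : ℤ) ^ 2 ∣ (k - k₀) * (l * (k + k₀) + 1) := by
      refine (hcop hg).dvd_of_dvd_mul_left ?_
      have := dvd_sub hk hk₀
      rwa [show g * (l * (k : ℤ) ^ 2 + k) + e - (g * (l * (k₀ : ℤ) ^ 2 + k₀) + e) =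
        g * ((k - k₀) * (l * (k + k₀) + 1)) by ring] at this
    by_cases hx : (p : ℤ) ∣ k - k₀
    · refine .inl ((hcop fun hy ↦ he ?_).dvd_of_dvd_mul_right hmul)
      have hz : (p : ℤ) ∣ 2 * l * k₀ + 1 := by
        have := dvd_sub hy (hx.mul_left l)
        rwa [show l * ((k : ℤ) + k₀) + 1 - l * (k - k₀) = 2 * l * k₀ + 1 by ring] at this
      have := dvd_sub (((dvd_pow_self (p : ℤ) two_ne_zero).trans hk₀).mul_left (4 * l))
        (hz.mul_left (g * (2 * l * k₀ + 1)))
      rwa [show 4 * l * (g * (l * (k₀ : ℤ) ^ 2 + k₀) + e) -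
        g * (2 * l * k₀ + 1) * (2 * l * k₀ + 1) = 4 * l * e - g by ring] at this
    · exact .inr ((hcop hx).dvd_of_dvd_mul_left hmul)
  by_cases h1 : ∃ k₁ : ℕ, (p : ℤ) ^ 2 ∣ l * (k₁ + k₀) + 1
  · obtain ⟨k₁, hk₁⟩ := h1
    refine ⟨k₀, k₁, fun k hk ↦ (hsplit k hk).imp (hmod _ _) fun h ↦ hmod _ _ ?_⟩
    refine (hcop hl).dvd_of_dvd_mul_left ?_
    have := dvd_sub h hk₁
    rwa [show l * ((k : ℤ) + k₀) + 1 - (l * (k₁ + k₀) + 1) = l * (k - k₁) by ring] at this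
  · exact ⟨k₀, k₀, fun k hk ↦ .inl (hmod _ _ ((hsplit k hk).resolve_right fun h ↦ h1 ⟨k, h⟩))⟩

/-! ### Arithmetic of `δ₁` and `δ₂` -/

theorem delta1_pos (k : ℤ) : 0 < delta1 k := by unfold delta1; nlinarith [sq_nonneg (6 * k + 1)]

theorem delta2_pos (k : ℤ) : 0 < delta2 k := by unfold delta2; nlinarith [sq_nonneg (2 * k + 1)]

theorem odd_delta1 (k : ℤ) : Odd (delta1 k) := by
  obtain ⟨m, hm⟩ := Int.even_mul_succ_self k
  exact ⟨9 * m - 3 * k, by unfold delta1; linear_combination 9 * hm⟩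

theorem odd_delta2 (k : ℤ) : Odd (delta2 k) := by
  obtain ⟨m, hm⟩ := Int.even_mul_succ_self k
  exact ⟨27 * m + 3, by unfold delta2; linear_combination 27 * hm⟩

theorem not_three_dvd_delta1 (k : ℤ) : ¬ 3 ∣ delta1 k := by unfold delta1; lia

theorem not_three_dvd_delta2 (k : ℤ) : ¬ 3 ∣ delta2 k := by unfold delta2; lia

theorem five_le_of_prime {p : ℕ} (hp : p.Prime) {n : ℤ} (hodd : Odd n) (h3 : ¬ 3 ∣ n)
    (hpn : (p : ℤ) ∣ n) : 5 ≤ p := by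
  by_contra! hlt
  have h2 := hp.two_le
  interval_cases p
  · exact Int.not_even_iff_odd.2 hodd (even_iff_two_dvd.2 hpn)
  · exact h3 hpn
  · norm_num at hp

theorem not_dvd_of_five_le {p : ℕ} (hp : p.Prime) (h5 : 5 ≤ p) (i j : ℕ) :
    ¬ (p : ℤ) ∣ 2 ^ i * 3 ^ j := by
  intro h
  have h' : p ∣ 2 ^ i * 3 ^ j := by exact_mod_cast h
  rcases (hp.dvd_mul.1 h').imp hp.dvd_of_dvd_pow hp.dvd_of_dvd_pow with h | h <;>
    · have := Nat.le_of_dvd (by norm_num) h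
      lia

/-- `D` is prime to `6`, so only `p ≥ 5` matter; the shapes `2 ^ _ * 3 ^ _` guarantee that such `p`
divide none of `g`, `l`, `4le - g`. -/
theorem infinite_squarefree_of_quadratic (D : ℤ → ℤ) (C : ℕ) (g l e : ℤ)
    (hD : ∀ k, D k = g * (l * k ^ 2 + k) + e) (hpos : ∀ k, 0 < D k) (hodd : ∀ k, Odd (D k))
    (h3 : ∀ k, ¬ 3 ∣ D k) (hbound : ∀ k N : ℕ, k < N → D k ≤ (C * N) ^ 2) {i j m n : ℕ}
    (hg : g = 2 ^ 0 * 3 ^ i) (hl : l = 2 ^ 0 * 3 ^ j) (he : 4 * l * e - g = 2 ^ m * 3 ^ n) :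
    {k : ℕ | Squarefree (D k)}.Infinite := by
  have hdvd (p k : ℕ) : p ^ 2 ∣ (D k).natAbs ↔ (p : ℤ) ^ 2 ∣ D k := by
    rw [← Int.natCast_dvd]
    push_cast
    rfl
  have h5 (p k : ℕ) (hp : p.Prime) (h : p ^ 2 ∣ (D k).natAbs) : 5 ≤ p :=
    five_le_of_prime hp (hodd k) (h3 k)
      ((dvd_pow_self (p : ℤ) two_ne_zero).trans ((hdvd p k).1 h))
  have := infinite_squarefree_of_two_residues (fun k ↦ (D k).natAbs) C
    (fun k ↦ Int.natAbs_ne_zero.2 (hpos k).ne')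
    (fun k N hk ↦ by
      zify
      rw [abs_of_pos (hpos k)]
      exact hbound k N hk) h5 (fun p hp ↦ ?_)
  · simpa only [Int.squarefree_natAbs] using this
  · by_cases hp5 : 5 ≤ p
    · obtain ⟨v, w, h⟩ := exists_two_residues_of_quadratic hp (g := g) (l := l) (e := e)
        (hg ▸ not_dvd_of_five_le hp hp5 0 i)
        (hl ▸ not_dvd_of_five_le hp hp5 0 j) (he ▸ not_dvd_of_five_le hp hp5 m n)
      exact ⟨v, w, fun k hk ↦ h k (by rw [← hD]; exact (hdvd p k).1 hk)⟩
    · exact ⟨0, 0, fun k hk ↦ (hp5 (h5 p k hp hk)).elim⟩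

theorem infinite_squarefree_delta1 : {k : ℕ | Squarefree (delta1 k)}.Infinite :=
  infinite_squarefree_of_quadratic delta1 4 3 3 1 (fun k ↦ by unfold delta1; ring) delta1_pos
    odd_delta1 not_three_dvd_delta1
    (fun k N h ↦ by
      have : (k : ℤ) + 1 ≤ N := by exact_mod_cast h
      unfold delta1
      push_cast
      nlinarith) (i := 1) (j := 1) (m := 0) (n := 2) (by norm_num) (by norm_num) (by norm_num)

theorem infinite_squarefree_delta2 : {k : ℕ | Squarefree (delta2 k)}.Infinite :=
  infinite_squarefree_of_quadratic delta2 6 27 1 7 (fun k ↦ by unfold delta2; ring) delta2_pos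
    odd_delta2 not_three_dvd_delta2
    (fun k N h ↦ by
      have : (k : ℤ) + 1 ≤ N := by exact_mod_cast h
      unfold delta2
      push_cast
      nlinarith) (i := 3) (j := 0) (m := 0) (n := 0) (by norm_num) (by norm_num) (by norm_num)

/-! ### The two families -/

theorem not_sq_dvd_mul_of_squarefree {p u n : ℤ} (hp : Prime p) (hn : Squarefree n)
    (hu : ¬ p ∣ u) : ¬ p ^ 2 ∣ u * n := by
  intro h
  have hcop : IsCoprime (p ^ 2) u := (hp.irreducible.coprime_iff_not_dvd.2 hu).pow_left
  exact hp.not_isUnit (hn p (by rw [← sq]; exact hcop.dvd_of_dvd_mul_left h))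

theorem eq_three_or_eq_neg_three {p : ℤ} (hp : Prime p) (h : p ∣ 3) : p = 3 ∨ p = -3 :=
  Int.associated_iff.1 (hp.irreducible.associated_of_dvd Int.prime_three.irreducible h)

theorem isMonogenicPoly_of_eisenstein_three {a b c r : ℤ} (h : IsMonicIrred (monicCubic a b c))
    (hD : monicCubicDiscr a b c = 3 ^ 4) (h2 : 3 ∣ 3 * r + a) (h1 : 3 ∣ 3 * r ^ 2 + 2 * a * r + b)
    (h0 : 3 ∣ r ^ 3 + a * r ^ 2 + b * r + c) (h0' : ¬ 3 ^ 2 ∣ r ^ 3 + a * r ^ 2 + b * r + c) :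
    IsMonogenicPoly (monicCubic a b c) := by
  refine isMonogenicPoly_of_eisenstein h fun p hp hpD ↦ ⟨r, ?_⟩
  rw [hD] at hpD
  rcases eq_three_or_eq_neg_three hp (hp.dvd_of_dvd_pow hpD) with rfl | rfl
  · exact ⟨h2, h1, h0, h0'⟩
  · rw [neg_sq]
    simp only [neg_dvd]
    exact ⟨h2, h1, h0, h0'⟩

noncomputable def family1Poly (k : ℤ) : ℤ[X] :=
  monicCubic 0 (-3 * delta1 k) ((6 * k + 1) * delta1 k)

noncomputable def family2Poly (k : ℤ) : ℤ[X] :=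
  monicCubic 0 (-delta2 k) ((2 * k + 1) * delta2 k)

theorem mem_family1_iff {f : ℤ[X]} :
    f ∈ Family1 ↔ ∃ k : ℤ, Squarefree (delta1 k) ∧ f = family1Poly k := by
  simp [Family1, family1Poly, monicCubic, sub_eq_add_neg]

theorem mem_family2_iff {f : ℤ[X]} :
    f ∈ Family2 ↔ ∃ k : ℤ, 0 ≤ k ∧ Squarefree (delta2 k) ∧ f = family2Poly k := by
  simp [Family2, family2Poly, monicCubic, sub_eq_add_neg]

theorem discr_family1Poly (k : ℤ) :
    (9 * delta1 k) ^ 2 = monicCubicDiscr 0 (-3 * delta1 k) ((6 * k + 1) * delta1 k) := by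
  unfold monicCubicDiscr delta1; ring

theorem discr_family2Poly (k : ℤ) :
    delta2 k ^ 2 = monicCubicDiscr 0 (-delta2 k) ((2 * k + 1) * delta2 k) := by
  unfold monicCubicDiscr delta2; ring

theorem isMonicIrred_family1Poly (k : ℤ) : IsMonicIrred (family1Poly k) := by
  apply isMonicIrred_monicCubic_of_odd
  · rw [zero_add]
    exact Odd.mul (by decide) (odd_delta1 k)
  · exact Odd.mul ⟨3 * k, by ring⟩ (odd_delta1 k)

theorem isMonicIrred_family2Poly (k : ℤ) : IsMonicIrred (family2Poly k) := by
  apply isMonicIrred_monicCubic_of_odd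
  · rw [zero_add]
    exact (odd_delta2 k).neg
  · exact Odd.mul ⟨k, by ring⟩ (odd_delta2 k)

theorem isCyclicPoly_family1Poly (k : ℤ) : IsCyclicPoly (family1Poly k) :=
  isCyclicPoly_of_discr_eq_sq (isMonicIrred_family1Poly k) (discr_family1Poly k)
    (mul_pos (by norm_num) (delta1_pos k)).ne'

theorem isCyclicPoly_family2Poly (k : ℤ) : IsCyclicPoly (family2Poly k) :=
  isCyclicPoly_of_discr_eq_sq (isMonicIrred_family2Poly k) (discr_family2Poly k)
    (delta2_pos k).ne'

theorem isMonogenicPoly_family1Poly {k : ℤ} (hk : Squarefree (delta1 k)) :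
    IsMonogenicPoly (family1Poly k) := by
  refine isMonogenicPoly_of_eisenstein (isMonicIrred_family1Poly k) fun p hp hpD ↦ ?_
  rw [← discr_family1Poly] at hpD
  have hpD := hp.dvd_of_dvd_pow hpD
  by_cases h3 : p ∣ 3
  -- As `δ₁ ≡ 1` modulo `3`, the polynomial is `x³ + 1 = (x + 1)³` there.
  · refine ⟨-1, ?_⟩
    have hval : (-1) ^ 3 + 0 * (-1) ^ 2 + -3 * delta1 k * -1 + (6 * k + 1) * delta1 k =
        9 * (6 * k ^ 3 + 6 * k ^ 2 + 2 * k) + 3 := by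
      unfold delta1; ring
    rw [hval]
    rcases eq_three_or_eq_neg_three hp h3 with rfl | rfl <;> norm_num <;> lia
  · have hpd : p ∣ delta1 k := by
      refine (hp.dvd_or_dvd hpD).resolve_left fun h ↦ h3 ?_
      exact hp.dvd_of_dvd_pow (n := 2) (by norm_num; exact h)
    refine ⟨0, by simp, by simpa using hpd.mul_left _, by simpa using hpd.mul_left _, ?_⟩
    -- `4δ₁ - (6k + 1)² = 3`.
    have hu : ¬ p ∣ 6 * k + 1 := fun hu ↦ h3 (by
      have := dvd_sub (hpd.mul_left 4) (hu.mul_left (6 * k + 1))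
      rwa [show 4 * delta1 k - (6 * k + 1) * (6 * k + 1) = 3 by unfold delta1; ring] at this)
    simpa using not_sq_dvd_mul_of_squarefree hp hk hu

theorem isMonogenicPoly_family2Poly {k : ℤ} (hk : Squarefree (delta2 k)) :
    IsMonogenicPoly (family2Poly k) := by
  refine isMonogenicPoly_of_eisenstein (isMonicIrred_family2Poly k) fun p hp hpD ↦ ?_
  rw [← discr_family2Poly] at hpD
  have hpd := hp.dvd_of_dvd_pow hpD
  refine ⟨0, by simp, by simpa using hpd, by simpa using hpd.mul_left _, ?_⟩
  have hu : ¬ p ∣ 2 * k + 1 := fun hu ↦ hp.not_isUnit (isUnit_of_dvd_one (by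
    have := dvd_sub (hpd.mul_left 4) (hu.mul_left (27 * (2 * k + 1)))
    rwa [show 4 * delta2 k - 27 * (2 * k + 1) * (2 * k + 1) = 1 by unfold delta2; ring] at this))
  simpa using not_sq_dvd_mul_of_squarefree hp hk hu

theorem delta1_injective : Function.Injective delta1 := by
  intro j k h
  have : (j - k) * (3 * (j + k) + 1) = 0 := by
    unfold delta1 at h
    linarith
  rcases mul_eq_zero.1 this with h | h <;> lia

/-- The symmetry `k ↦ -1 - k` of `δ₂` is the only coincidence, and `k ≥ 0` removes it. -/
theorem delta2_injOn : Set.InjOn delta2 {k | 0 ≤ k} := by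
  intro j hj k hk h
  rw [Set.mem_ofPred_eq] at hj hk
  have : (j - k) * (j + k + 1) = 0 := by
    unfold delta2 at h
    linarith
  rcases mul_eq_zero.1 this with h | h <;> lia

theorem family1_infinite : Family1.Infinite := by
  refine (infinite_squarefree_delta1.image (f := fun k : ℕ ↦ family1Poly k) ?_).mono ?_
  · intro j _ k _ h
    have := (monicCubic_eq_iff.1 h).2.1
    exact Nat.cast_injective (delta1_injective (by linarith))
  · rintro _ ⟨k, hk, rfl⟩
    exact mem_family1_iff.2 ⟨k, hk, rfl⟩

theorem family2_infinite : Family2.Infinite := by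
  refine (infinite_squarefree_delta2.image (f := fun k : ℕ ↦ family2Poly k) ?_).mono ?_
  · intro j _ k _ h
    have := (monicCubic_eq_iff.1 h).2.1
    exact_mod_cast delta2_injOn (Int.natCast_nonneg j) (Int.natCast_nonneg k) (by linarith)
  · rintro _ ⟨k, hk, rfl⟩
    exact mem_family2_iff.2 ⟨k, Int.natCast_nonneg k, hk, rfl⟩

theorem family1_inter_family2 : Family1 ∩ Family2 = ∅ := by
  refine Set.eq_empty_of_forall_notMem ?_
  rintro f ⟨hf1, hf2⟩
  obtain ⟨k, -, rfl⟩ := mem_family1_iff.1 hf1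
  obtain ⟨j, -, -, h⟩ := mem_family2_iff.1 hf2
  have := (monicCubic_eq_iff.1 h).2.1
  exact not_three_dvd_delta2 j ⟨delta1 k, by linarith⟩

theorem monicCubicDiscr_eq_of_polyEquivalent {a b c a' b' c' : ℤ}
    (hm : IsMonogenicPoly (monicCubic a b c)) (hc : IsCyclicPoly (monicCubic a b c))
    (hm' : IsMonogenicPoly (monicCubic a' b' c')) (hc' : IsCyclicPoly (monicCubic a' b' c'))
    (h : PolyEquivalent (monicCubic a b c) (monicCubic a' b' c')) :
    monicCubicDiscr a b c = monicCubicDiscr a' b' c' := by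
  obtain ⟨t, ht⟩ := exists_root_monicCubic a b c
  obtain ⟨s, hs⟩ := exists_root_monicCubic a' b' c'
  obtain ⟨d, hd0, hd⟩ := exists_sq_eq_discr_of_isCyclicPoly hc
  obtain ⟨d', hd0', hd'⟩ := exists_sq_eq_discr_of_isCyclicPoly hc'
  rw [PolyEquivalent, splittingFieldIn_monicCubic hd hd0 ht,
    splittingFieldIn_monicCubic hd' hd0' hs] at h
  have : FiniteDimensional ℚ ℚ⟮t⟯ := adjoin.finiteDimensional (isIntegral_rat_of_monicCubic ht)
  have : FiniteDimensional ℚ ℚ⟮s⟯ := adjoin.finiteDimensional (isIntegral_rat_of_monicCubic hs)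
  have : NumberField ℚ⟮t⟯ := ⟨⟩
  have : NumberField ℚ⟮s⟯ := ⟨⟩
  rw [← discr_eq_of_isMonogenicPoly hm ht, ← discr_eq_of_isMonogenicPoly hm' hs]
  exact NumberField.discr_eq_discr_of_algEquiv _ (equivOfEq h)

theorem not_polyEquivalent_of_mem_families {f g : ℤ[X]} (hf : f ∈ Family1 ∪ Family2)
    (hg : g ∈ Family1 ∪ Family2) (hfg : f ≠ g) : ¬ PolyEquivalent f g := by
  intro h
  have mixed (j k : ℤ) : (9 * delta1 j) ^ 2 ≠ delta2 k ^ 2 := fun h ↦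
    not_three_dvd_delta2 k (Int.prime_three.dvd_of_dvd_pow (n := 2)
      ⟨27 * delta1 j ^ 2, by rw [← h]; ring⟩)
  rcases hf with hf | hf <;> rcases hg with hg | hg
  · obtain ⟨j, hj, rfl⟩ := mem_family1_iff.1 hf
    obtain ⟨k, hk, rfl⟩ := mem_family1_iff.1 hg
    have hd := monicCubicDiscr_eq_of_polyEquivalent (isMonogenicPoly_family1Poly hj)
      (isCyclicPoly_family1Poly j) (isMonogenicPoly_family1Poly hk) (isCyclicPoly_family1Poly k) h
    rw [← discr_family1Poly, ← discr_family1Poly, sq_eq_sq₀ (by linarith [delta1_pos j])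
      (by linarith [delta1_pos k])] at hd
    exact hfg (congrArg _ (delta1_injective (by linarith)))
  · obtain ⟨j, hj, rfl⟩ := mem_family1_iff.1 hf
    obtain ⟨k, -, hk, rfl⟩ := mem_family2_iff.1 hg
    have hd := monicCubicDiscr_eq_of_polyEquivalent (isMonogenicPoly_family1Poly hj)
      (isCyclicPoly_family1Poly j) (isMonogenicPoly_family2Poly hk) (isCyclicPoly_family2Poly k) h
    rw [← discr_family1Poly, ← discr_family2Poly] at hd
    exact mixed _ _ hd
  · obtain ⟨j, -, hj, rfl⟩ := mem_family2_iff.1 hf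
    obtain ⟨k, hk, rfl⟩ := mem_family1_iff.1 hg
    have hd := monicCubicDiscr_eq_of_polyEquivalent (isMonogenicPoly_family2Poly hj)
      (isCyclicPoly_family2Poly j) (isMonogenicPoly_family1Poly hk) (isCyclicPoly_family1Poly k) h
    rw [← discr_family1Poly, ← discr_family2Poly] at hd
    exact mixed _ _ hd.symm
  · obtain ⟨j, hj0, hj, rfl⟩ := mem_family2_iff.1 hf
    obtain ⟨k, hk0, hk, rfl⟩ := mem_family2_iff.1 hg
    have hd := monicCubicDiscr_eq_of_polyEquivalent (isMonogenicPoly_family2Poly hj)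
      (isCyclicPoly_family2Poly j) (isMonogenicPoly_family2Poly hk) (isCyclicPoly_family2Poly k) h
    rw [← discr_family2Poly, ← discr_family2Poly, sq_eq_sq₀ (delta2_pos j).le
      (delta2_pos k).le] at hd
    exact hfg (congrArg _ (delta2_injOn hj0 hk0 hd))

/-! ### The four exceptional trinomials -/

theorem fourTrinomials_eq : FourTrinomials =
    {monicCubic 3 0 (-3), monicCubic (-3) 0 3, monicCubic (-3) 0 1, monicCubic 3 0 (-1)} := by
  simp [FourTrinomials, monicCubic, sub_eq_add_neg]

theorem ncard_fourTrinomials : FourTrinomials.ncard = 4 := by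
  rw [fourTrinomials_eq]
  repeat rw [Set.ncard_insert_of_notMem (by simp [monicCubic_eq_iff])]
  rw [Set.ncard_singleton]

theorem isMonogenicPoly_and_isCyclicPoly_of_mem_fourTrinomials {f : ℤ[X]}
    (hf : f ∈ FourTrinomials) : IsMonogenicPoly f ∧ IsCyclicPoly f := by
  rw [fourTrinomials_eq] at hf
  -- All four have discriminant `81`; `r` is the triple root modulo `3`, at which the translate is
  -- Eisenstein.
  have key {a c r : ℤ} (ha : Odd a) (hc : Odd c) (hD : monicCubicDiscr a 0 c = 3 ^ 4)
      (h2 : 3 ∣ 3 * r + a) (h1 : 3 ∣ 3 * r ^ 2 + 2 * a * r + 0)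
      (h0 : 3 ∣ r ^ 3 + a * r ^ 2 + 0 * r + c) (h0' : ¬ 3 ^ 2 ∣ r ^ 3 + a * r ^ 2 + 0 * r + c) :
      IsMonogenicPoly (monicCubic a 0 c) ∧ IsCyclicPoly (monicCubic a 0 c) := by
    have hirr := isMonicIrred_monicCubic_of_odd (a := a) (b := 0) (by simpa using ha) hc
    exact ⟨isMonogenicPoly_of_eisenstein_three hirr hD h2 h1 h0 h0',
      isCyclicPoly_of_discr_eq_sq (d := 9) hirr (by rw [hD]; norm_num) (by norm_num)⟩
  rcases hf with rfl | rfl | rfl | rfl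
  · exact key (r := 0) (by decide) (by decide) (by decide) (by decide) (by decide) (by decide)
      (by decide)
  · exact key (r := 0) (by decide) (by decide) (by decide) (by decide) (by decide) (by decide)
      (by decide)
  · exact key (r := 2) (by decide) (by decide) (by decide) (by decide) (by decide) (by decide)
      (by decide)
  · exact key (r := -2) (by decide) (by decide) (by decide) (by decide) (by decide) (by decide)
      (by decide)

theorem mem_fourTrinomials_of_isMonogenicPoly {A B : ℤ} (hAB : A * B ≠ 0)
    (hm : IsMonogenicPoly (monicCubic A 0 B)) (hc : IsCyclicPoly (monicCubic A 0 B)) :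
    monicCubic A 0 B ∈ FourTrinomials := by
  obtain ⟨d, hd0, hd⟩ := exists_sq_eq_discr_of_isCyclicPoly hc
  have := eq_of_discr_eq_sq (left_ne_zero_of_mul hAB) (right_ne_zero_of_mul hAB) hd0
    (by rw [hd]; unfold monicCubicDiscr; ring)
    fun p hp r h0 h1 ↦ not_isMonogenicPoly_of_sq_dvd_eval hp r (by simpa using h0)
      (by simpa using h1) hm
  rw [fourTrinomials_eq]
  rcases this with ⟨rfl, rfl⟩ | ⟨rfl, rfl⟩ | ⟨rfl, rfl⟩ | ⟨rfl, rfl⟩ <;> simp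

/-- For a root `t` of `x³ - 3x + 1`, the numbers `-t - 1`, `t + 1`, `1/t`, `-1/t` are roots of the
four trinomials, and each generates `ℚ(t)`. -/
theorem polyEquivalent_of_mem_fourTrinomials {f : ℤ[X]} (hf : f ∈ FourTrinomials) :
    PolyEquivalent f (monicCubic 0 (-3) 1) := by
  obtain ⟨t, ht⟩ := exists_root_monicCubic 0 (-3) 1
  rw [PolyEquivalent, splittingFieldIn_monicCubic (d := 9) (by decide) (by decide) ht]
  push_cast at ht
  have ht0 : t ≠ 0 := by
    rintro rfl
    norm_num at ht
  have hmem := mem_adjoin_simple_self ℚ t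
  have key {a c : ℤ} {s : ℂ} (hD : (9 : ℤ) ^ 2 = monicCubicDiscr a 0 c)
      (hs : s ^ 3 + a * s ^ 2 + (0 : ℤ) * s + c = 0) (h1 : s ∈ ℚ⟮t⟯) (h2 : t ∈ ℚ⟮s⟯) :
      splittingFieldIn (monicCubic a 0 c) = ℚ⟮t⟯ := by
    rw [splittingFieldIn_monicCubic hD (by norm_num) hs]
    exact le_antisymm (adjoin_simple_le_iff.2 h1) (adjoin_simple_le_iff.2 h2)
  rw [fourTrinomials_eq] at hf
  rcases hf with rfl | rfl | rfl | rfl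
  · refine key (s := -t - 1) (by decide) (by push_cast; linear_combination -ht)
      (sub_mem (neg_mem hmem) (one_mem _)) ?_
    have := sub_mem (neg_mem (mem_adjoin_simple_self ℚ (-t - 1))) (one_mem _)
    ring_nf at this ⊢
    exact this
  · refine key (s := t + 1) (by decide) (by push_cast; linear_combination ht)
      (add_mem hmem (one_mem _)) ?_
    have := sub_mem (mem_adjoin_simple_self ℚ (t + 1)) (one_mem _)
    rwa [add_sub_cancel_right] at this
  · refine key (s := t⁻¹) (by decide) ?_ (inv_mem hmem) ?_
    · push_cast
      field_simp
      linear_combination ht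
    · have := inv_mem (mem_adjoin_simple_self ℚ t⁻¹)
      rwa [inv_inv] at this
  · refine key (s := -t⁻¹) (by decide) ?_ (neg_mem (inv_mem hmem)) ?_
    · push_cast
      field_simp
      linear_combination -ht
    · have := inv_mem (neg_mem (mem_adjoin_simple_self ℚ (-t⁻¹)))
      rwa [neg_neg, inv_inv] at this

theorem trinomial_mem_family1 : monicCubic 0 (-3) 1 ∈ Family1 :=
  mem_family1_iff.2 ⟨0, by simp [delta1], by simp [family1Poly, delta1]⟩

theorem theorem1p1 :
    (Family1.Infinite ∧ Family2.Infinite ∧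
      (∀ f ∈ Family1 ∪ Family2,
        (∃ A B : ℤ, A * B ≠ 0 ∧ f = X ^ 3 + C A * X + C B) ∧
          IsMonogenicPoly f ∧ IsCyclicPoly f) ∧
      Family1 ∩ Family2 = ∅ ∧
      (∀ f ∈ Family1 ∪ Family2, ∀ g ∈ Family1 ∪ Family2, f ≠ g → ¬ PolyEquivalent f g)) ∧
    ({f : ℤ[X] | (∃ A B : ℤ, A * B ≠ 0 ∧ f = X ^ 3 + C A * X ^ 2 + C B) ∧
        IsMonogenicPoly f ∧ IsCyclicPoly f} = FourTrinomials ∧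
      FourTrinomials.ncard = 4 ∧
      (X ^ 3 - 3 * X + 1 : ℤ[X]) ∈ Family1 ∧
      (∀ f ∈ FourTrinomials, PolyEquivalent f (X ^ 3 - 3 * X + 1))) := by
  have htri : (X ^ 3 - 3 * X + 1 : ℤ[X]) = monicCubic 0 (-3) 1 := by
    simp [monicCubic, sub_eq_add_neg]
  have hform (A B : ℤ) : X ^ 3 + C A * X ^ 2 + C B = monicCubic A 0 B := by simp [monicCubic]
  have hform' (A B : ℤ) : monicCubic 0 A B = X ^ 3 + C A * X + C B := by simp [monicCubic]
  refine ⟨⟨family1_infinite, family2_infinite, ?_, family1_inter_family2,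
    fun f hf g hg ↦ not_polyEquivalent_of_mem_families hf hg⟩, ?_, ncard_fourTrinomials,
    htri ▸ trinomial_mem_family1, fun f hf ↦ htri ▸ polyEquivalent_of_mem_fourTrinomials hf⟩
  · rintro f (hf | hf)
    · obtain ⟨k, hk, rfl⟩ := mem_family1_iff.1 hf
      refine ⟨⟨_, _, ?_, hform' _ _⟩, isMonogenicPoly_family1Poly hk, isCyclicPoly_family1Poly k⟩
      have h0 := (delta1_pos k).ne'
      exact mul_ne_zero (mul_ne_zero (by norm_num) h0) (mul_ne_zero (by lia) h0)
    · obtain ⟨k, -, hk, rfl⟩ := mem_family2_iff.1 hf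
      refine ⟨⟨_, _, ?_, hform' _ _⟩, isMonogenicPoly_family2Poly hk, isCyclicPoly_family2Poly k⟩
      have h0 := (delta2_pos k).ne'
      exact mul_ne_zero (neg_ne_zero.2 h0) (mul_ne_zero (by lia) h0)
  · ext f
    constructor
    · rintro ⟨⟨A, B, hAB, rfl⟩, hm, hc⟩
      rw [hform] at hm hc ⊢
      exact mem_fourTrinomials_of_isMonogenicPoly hAB hm hc
    · intro hf
      refine ⟨?_, isMonogenicPoly_and_isCyclicPoly_of_mem_fourTrinomials hf⟩
      rw [fourTrinomials_eq] at hf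
      rcases hf with rfl | rfl | rfl | rfl <;>
        exact ⟨_, _, by norm_num, (hform _ _).symm⟩
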